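/- Let $T=(T_1,\dots,T_n)$ be a row contraction on a complex Hilbert space $\mathcal H$, i.e. the row operator $T:\mathcal H^n\to\mathcal H$, $T(h_1,\dots,h_n)=\sum_i T_ih_i$, is a contraction. Put $D_T=(I-T^*T)^{1/2}$ on $\mathcal H^n$, $D_{T^*}=(I-TT^*)^{1/2}$ on $\mathcal H$, $\mathcal D_T=\overline{\operatorname{ran}}\,D_T$ and $\mathcal D_{T^*}=\overline{\operatorname{ran}}\,D_{T^*}$. Let $\Gamma$ be the full Fock space over $\mathbb C^n$, with orthonormal basis $e_\alpha$ indexed by the words $\alpha$ in the letters $1,\dots,n$, left creation operators $L_i$ and right creation operators $R_i$. An operator $M\in\mathcal B(\Gamma\otimes\mathcal E_1,\Gamma\otimes\mathcal E_2)$ with $M(L_i\otimes I)=(L_i\otimes I)M$ for all $i$ is called multi-analytic; it has a formal Fourier expansion $M\sim\sum_\alpha R^\alpha\otimes\theta_\alpha$, where $\langle\theta_\alpha\eta,\eta_*\rangle=\langle M(e_\emptyset\otimes\eta),e_{\bar\alpha}\otimes\eta_*\rangle$ and $\bar\alpha$ is the reverse of $\alpha$. The characteristic function of $T$ is the multi-analytic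 operator $\Theta_T\in\mathcal B(\Gamma\otimes\mathcal D_T,\Gamma\otimes\mathcal D_{T^*})$, $$\Theta_T\sim -I_\Gamma\otimes T+(I_\Gamma\otimes D_{T^*})\Big(I-\sum_i R_i\otimes T_i^*\Big)^{-1}(R_1\otimes I,\dots,R_n\otimes I)(I_\Gamma\otimes D_T),$$ i.e. its Fourier coefficients are $\theta_\emptyset=-T|_{\mathcal D_T}$ and $\theta_{\alpha_1\cdots\alpha_kj}=D_{T^*}T_{\alpha_1}^*\cdots T_{\alpha_k}^*P_jD_T|_{\mathcal D_T}$, where $P_j:\mathcal H^n\to\mathcal H$ is the $j$-th coordinate. Suppose that $\Theta_T$ is a noncommutative polynomial of degree $m$, i.e. $\theta_\beta=0$ for all $|\beta|>m$ and $\theta_\alpha\ne0$ for some $|\alpha|=m$ (the zero polynomial being assigned degree $0$). Then there exist a Hilbert space $\mathcal E$, a row contraction $N=(N_1,\dots,N_n)$ on some Hilbert space which is nilpotent of some order $k\le m$ (that is, $N^\alpha=0$ for all words $\alpha$ of length $k$, and $k$ is the least such number; order $0$ means that the space is $\{0\}$), a co-isometry $G_1\in\mathcal B(\Gamma\otimes(\mathcal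 D_{N^*}\oplus\mathcal E),\Gamma\otimes\mathcal D_{T^*})$ and an isometry $G_2\in\mathcal B(\Gamma\otimes\mathcal D_T,\Gamma\otimes(\mathcal D_N\oplus\mathcal E))$, both constant, i.e. of the form $G_1=I_\Gamma\otimes V_1$ and $G_2=I_\Gamma\otimes V_2$ with bounded operators $V_1:\mathcal D_{N^*}\oplus\mathcal E\to\mathcal D_{T^*}$ and $V_2:\mathcal D_T\to\mathcal D_N\oplus\mathcal E$, such that $$\Theta_T=G_1\begin{bmatrix}\Theta_N&0\\0&I_{\Gamma\otimes\mathcal E}\end{bmatrix}G_2 .$$ -/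

import Mathlib

open scoped InnerProduct ENNReal

set_option linter.unusedSectionVars false

universe u

namespace RowOperators

noncomputable section

/-! ## Row contractions and defect spaces -/

section Rows

variable {H K : Type*} [NormedAddCommGroup H] [InnerProductSpace ℂ H] [CompleteSpace H]
  [NormedAddCommGroup K] [InnerProductSpace ℂ K] [CompleteSpace K] {n : ℕ}

/-- The row operator `(h₁, …, hₙ) ↦ ∑ i, Tᵢ hᵢ` from the Hilbert space `Hⁿ` to `H`. -/
def rowOp (T : Fin n → H →L[ℂ] H) : PiLp 2 (fun _ : Fin n => H) →L[ℂ] H :=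
  ∑ i, T i ∘L PiLp.proj 2 (fun _ : Fin n => H) i

/-- `T = (T₁, …, Tₙ)` is a row contraction if its row operator is a contraction. -/
def IsRowContraction (T : Fin n → H →L[ℂ] H) : Prop := ‖rowOp T‖ ≤ 1

/-- The defect operator `D_A = (I - A* A)^{1/2}`. -/
def defectOp (A : H →L[ℂ] K) : H →L[ℂ] H := CFC.sqrt (1 - A† ∘L A)

/-- The defect space `𝓓_A`, the closure of the range of `D_A`. -/
abbrev defectSpace (A : H →L[ℂ] K) : Submodule ℂ H :=
  (LinearMap.range (defectOp A).toLinearMap).topologicalClosure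

/-- `𝓓_T ⊆ Hⁿ`. -/
abbrev DT (T : Fin n → H →L[ℂ] H) : Submodule ℂ (PiLp 2 (fun _ : Fin n => H)) :=
  defectSpace (rowOp T)

/-- `𝓓_{T*} ⊆ H`. -/
abbrev DTs (T : Fin n → H →L[ℂ] H) : Submodule ℂ H := defectSpace ((rowOp T)†)

/-- `T^α = T_{α₁} ⋯ T_{αₖ}` for a word `α = α₁ ⋯ αₖ` of the free semigroup on `n` letters. -/
def wordProd (T : Fin n → H →L[ℂ] H) (α : List (Fin n)) : H →L[ℂ] H := (α.map T).prod

/-- `N` is nilpotent of order `k`: `N^α = 0` for all words of length `k`, and `k` is the least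
such number, i.e. for every `j < k` some `N^β` with `|β| = j` is nonzero. Since `N^∅ = I`,
order `0` means that the space is `{0}`, and order `1` means that `N = 0` on a nonzero space. -/
def IsNilpotentOfOrder (N : Fin n → H →L[ℂ] H) (k : ℕ) : Prop :=
  (∀ α : List (Fin n), α.length = k → wordProd N α = 0) ∧
    ∀ j < k, ∃ β : List (Fin n), β.length = j ∧ wordProd N β ≠ 0

/-! Facts on defect operators of contractions. -/

theorem one_sub_nonneg {A : H →L[ℂ] K} (hA : ‖A‖ ≤ 1) :
    (0 : H →L[ℂ] H) ≤ 1 - A† ∘L A := by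
  rw [ContinuousLinearMap.nonneg_iff_isPositive, ContinuousLinearMap.isPositive_def']
  refine ⟨?_, fun x => ?_⟩
  · rw [ContinuousLinearMap.isSelfAdjoint_iff']
    rw [← ContinuousLinearMap.star_eq_adjoint, star_sub, star_one,
      ContinuousLinearMap.star_eq_adjoint, ContinuousLinearMap.adjoint_comp,
      ContinuousLinearMap.adjoint_adjoint]
  · rw [ContinuousLinearMap.reApplyInnerSelf_apply]
    simp only [sub_apply, one_apply_eq_self,
      ContinuousLinearMap.comp_apply, inner_sub_left, map_sub,
      ContinuousLinearMap.adjoint_inner_left, inner_self_eq_norm_sq]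
    have h : ‖A x‖ ≤ ‖x‖ := by simpa using A.le_of_opNorm_le hA x
    have := pow_le_pow_left₀ (norm_nonneg _) h 2
    linarith

theorem defectOp_sq {A : H →L[ℂ] K} (hA : ‖A‖ ≤ 1) :
    defectOp A ∘L defectOp A = 1 - A† ∘L A :=
  CFC.sqrt_mul_sqrt_self _ (one_sub_nonneg hA)

theorem defectOp_nonneg (A : H →L[ℂ] K) : 0 ≤ defectOp A := CFC.sqrt_nonneg _

theorem defectOp_adjoint (A : H →L[ℂ] K) : (defectOp A)† = defectOp A :=
  ((ContinuousLinearMap.nonneg_iff_isPositive _).1 (defectOp_nonneg A)).isSelfAdjoint.adjoint_eq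

theorem norm_adjoint_le_one {A : H →L[ℂ] K} (hA : ‖A‖ ≤ 1) : ‖A†‖ ≤ 1 := by
  rwa [LinearIsometryEquiv.norm_map]

theorem norm_sq_defectOp {A : H →L[ℂ] K} (hA : ‖A‖ ≤ 1) (x : H) :
    ‖defectOp A x‖ ^ 2 = ‖x‖ ^ 2 - ‖A x‖ ^ 2 := by
  have h1 := ContinuousLinearMap.apply_norm_sq_eq_inner_adjoint_left (defectOp A) x
  rw [defectOp_adjoint, defectOp_sq hA] at h1
  rw [h1]
  simp [inner_sub_left, ContinuousLinearMap.adjoint_inner_left, inner_self_eq_norm_sq_to_K]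
  norm_cast

/-- The block diagonal operator on a Hilbert space direct sum, for operators on its summands. -/
def blockDiag (P : H →L[ℂ] H) (Q : K →L[ℂ] K) : WithLp 2 (H × K) →L[ℂ] WithLp 2 (H × K) :=
  ((WithLp.prodContinuousLinearEquiv 2 ℂ H K).symm : H × K →L[ℂ] WithLp 2 (H × K)) ∘L
    (P.prodMap Q) ∘L (WithLp.prodContinuousLinearEquiv 2 ℂ H K : WithLp 2 (H × K) →L[ℂ] H × K)

theorem blockDiag_nonneg {P : H →L[ℂ] H} {Q : K →L[ℂ] K} (hP : 0 ≤ P) (hQ : 0 ≤ Q) :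
    0 ≤ blockDiag P Q := by
  rw [ContinuousLinearMap.nonneg_iff_isPositive, ContinuousLinearMap.isPositive_iff_complex] at *
  intro x
  have h1 := hP x.fst
  have h2 := hQ x.snd
  have h : inner ℂ (blockDiag P Q x) x = inner ℂ (P x.fst) x.fst + inner ℂ (Q x.snd) x.snd := by
    rw [WithLp.prod_inner_apply]; rfl
  rw [h]
  refine ⟨?_, ?_⟩
  · rw [map_add, ← h1.1, ← h2.1]; simp
  · rw [map_add]; exact add_nonneg h1.2 h2.2

theorem commute_of_mul_self {S W : H →L[ℂ] H} (h : Commute (S * S) W) (hS : 0 ≤ S) :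
    Commute S W := by
  have h' : Commute (CFC.sqrt (S * S)) W := h.cfcₙ_nnreal _
  rwa [CFC.sqrt_mul_self S hS] at h'

/-- `A D_A = D_{A*} A`. -/
theorem defectOp_intertwine {A : H →L[ℂ] K} (hA : ‖A‖ ≤ 1) (x : H) :
    A (defectOp A x) = defectOp (A†) (A x) := by
  set P : H →L[ℂ] H := 1 - A† ∘L A
  set Q : K →L[ℂ] K := 1 - ((A†)†) ∘L A†
  have hP : 0 ≤ P := one_sub_nonneg hA
  have hQ : 0 ≤ Q := one_sub_nonneg (norm_adjoint_le_one hA)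
  let W : WithLp 2 (H × K) →L[ℂ] WithLp 2 (H × K) :=
    ((WithLp.prodContinuousLinearEquiv 2 ℂ H K).symm : H × K →L[ℂ] WithLp 2 (H × K)) ∘L
      ContinuousLinearMap.inr ℂ H K ∘L A ∘L ContinuousLinearMap.fst ℂ H K ∘L
      (WithLp.prodContinuousLinearEquiv 2 ℂ H K : WithLp 2 (H × K) →L[ℂ] H × K)
  have hcomm : Commute (blockDiag P Q) W := by
    ext y
    all_goals simp [blockDiag, W, P, Q]
  have hs : blockDiag P Q =
      blockDiag (CFC.sqrt P) (CFC.sqrt Q) * blockDiag (CFC.sqrt P) (CFC.sqrt Q) := by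
    have h1 := CFC.sqrt_mul_sqrt_self P hP
    have h2 := CFC.sqrt_mul_sqrt_self Q hQ
    conv_lhs => rw [← h1, ← h2]
    rfl
  rw [hs] at hcomm
  have h3 : Commute (blockDiag (CFC.sqrt P) (CFC.sqrt Q)) W :=
    commute_of_mul_self hcomm (blockDiag_nonneg (CFC.sqrt_nonneg _) (CFC.sqrt_nonneg _))
  have h4 := congrArg (fun Z => (Z (WithLp.toLp 2 (x, (0 : K)))).snd) h3.eq
  have h5 : A (CFC.sqrt P x) = CFC.sqrt Q (A x) := by simpa [blockDiag, W] using h4.symm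
  exact h5

theorem defectOp_mem (A : H →L[ℂ] K) (x : H) : defectOp A x ∈ defectSpace A :=
  Submodule.le_topologicalClosure _ ⟨x, rfl⟩

theorem map_mem_defectSpace {A : H →L[ℂ] K} (hA : ‖A‖ ≤ 1) {x : H} (hx : x ∈ defectSpace A) :
    A x ∈ defectSpace (A†) := by
  have hmaps : Set.MapsTo A (LinearMap.range (defectOp A).toLinearMap : Set H)
      (LinearMap.range (defectOp (A†)).toLinearMap : Set K) := by
    rintro _ ⟨y, rfl⟩
    exact ⟨A y, (defectOp_intertwine hA y).symm⟩
  exact hmaps.closure A.continuous hx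

/-- Unitarity of the Julia operator of `A`. -/
theorem julia_norm {A : H →L[ℂ] K} (hA : ‖A‖ ≤ 1) (x : H) (y : K) :
    ‖-A x + defectOp (A†) y‖ ^ 2 + ‖defectOp A x + (A†) y‖ ^ 2 = ‖x‖ ^ 2 + ‖y‖ ^ 2 := by
  rw [@norm_add_sq ℂ, @norm_add_sq ℂ, norm_neg, norm_sq_defectOp hA,
    norm_sq_defectOp (norm_adjoint_le_one hA)]
  have h : inner ℂ (-A x) (defectOp (A†) y) = - inner ℂ (defectOp A x) ((A†) y) := by
    rw [ContinuousLinearMap.adjoint_inner_right, defectOp_intertwine hA, inner_neg_left,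
      ← ContinuousLinearMap.adjoint_inner_left, defectOp_adjoint]
  rw [h, map_neg]
  ring

theorem rowOp_adjoint_apply (T : Fin n → H →L[ℂ] H) (x : H) (j : Fin n) :
    (((rowOp T)†) x) j = ((T j)†) x := by
  refine ext_inner_left ℂ fun v => ?_
  have h := ContinuousLinearMap.adjoint_inner_right (rowOp T) (PiLp.single 2 j v) x
  rw [PiLp.inner_apply] at h
  rw [ContinuousLinearMap.adjoint_inner_right]
  have e1 : rowOp T (PiLp.single 2 j v) = T j v := by
    simp only [rowOp, sum_apply, ContinuousLinearMap.comp_apply]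
    rw [Finset.sum_eq_single j]
    · simp
    · intro b _ hb
      simp [hb]
    · simp
  rw [e1] at h
  rw [← h, Finset.sum_eq_single j]
  · simp
  · intro b _ hb
    simp [hb]
  · simp

end Rows

/-! ## The full Fock space and multi-analytic operators -/

section Fock

variable {n : ℕ} {E F E' F' : Type*} [NormedAddCommGroup E] [InnerProductSpace ℂ E]
  [NormedAddCommGroup F] [InnerProductSpace ℂ F]
  [NormedAddCommGroup E'] [InnerProductSpace ℂ E']
  [NormedAddCommGroup F'] [InnerProductSpace ℂ F']

/-- The Hilbert space tensor product `Γ ⊗ E` of the full Fock space `Γ` over `ℂⁿ` with `E`. As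
`{e_α}`, indexed by the words `α` in `n` letters, is an orthonormal basis of `Γ`, it is the space
of square-summable families `(f_α)` in `E`, which stand for `∑ e_α ⊗ f_α`. -/
abbrev Fock (n : ℕ) (E : Type*) [NormedAddCommGroup E] : Type _ :=
  lp (fun _ : List (Fin n) => E) 2

/-- `e_α ⊗ η`. -/
def elem (α : List (Fin n)) : E →L[ℂ] Fock n E :=
  lp.singleContinuousLinearMap ℂ (fun _ : List (Fin n) => E) 2 α

/-- `I_Γ ⊗ V`. -/
def ampl (n : ℕ) (V : E →L[ℂ] F) : Fock n E →L[ℂ] Fock n F :=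
  lp.mapCLM 2 (fun _ => V) (norm_nonneg V) (fun _ => le_rfl)

/-- The coefficients of `(L_i ⊗ I) f`: the coefficient of `e_i ⊗ e_δ` is that of `e_δ` in `f`. -/
def shiftFun (i : Fin n) (f : List (Fin n) → E) : List (Fin n) → E
  | [] => 0
  | j :: δ => if j = i then f δ else 0

theorem hasSum_shiftFun (i : Fin n) (f : Fock n E) :
    HasSum (fun γ => ‖shiftFun i f γ‖ ^ (2 : ℝ≥0∞).toReal) (‖f‖ ^ (2 : ℝ≥0∞).toReal) := by
  have h := lp.hasSum_norm (by norm_num : 0 < (2 : ℝ≥0∞).toReal) f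
  have hinj : Function.Injective (fun δ : List (Fin n) => i :: δ) := List.cons_injective
  refine (hinj.hasSum_iff ?_).1 ?_
  · intro γ hγ
    have : shiftFun i f γ = 0 := by
      cases γ with
      | nil => rfl
      | cons j δ =>
        have : j ≠ i := fun h => hγ ⟨δ, by simp [h]⟩
        simp [shiftFun, this]
    simp [this]
  · convert h using 2
    simp [shiftFun]

/-- The operator `L_i ⊗ I_E`, where `L_i` is the left creation operator `f ↦ e_i ⊗ f`. -/
def leftCreation (E : Type*) [NormedAddCommGroup E] [InnerProductSpace ℂ E] (i : Fin n) :
    Fock n E →L[ℂ] Fock n E :=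
  LinearMap.mkContinuous
    { toFun f := ⟨shiftFun i f, memℓp_gen (hasSum_shiftFun i f).summable⟩
      map_add' f g := by
        ext1
        funext γ
        change shiftFun i (f + g : Fock n E) γ = shiftFun i f γ + shiftFun i g γ
        cases γ with
        | nil => simp [shiftFun]
        | cons j δ => by_cases h : j = i <;> simp [shiftFun, h]
      map_smul' c f := by
        ext γ
        cases γ with
        | nil => simp [shiftFun]
        | cons j δ => by_cases h : j = i <;> simp [shiftFun, h] } 1
    fun f => by
      rw [one_mul]
      exact lp.norm_le_of_tsum_le (by norm_num) (norm_nonneg _) (hasSum_shiftFun i f).tsum_eq.le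

/-- `M (L_i ⊗ I) = (L_i ⊗ I) M` for all `i`. -/
def IsMultiAnalytic (M : Fock n E →L[ℂ] Fock n F) : Prop :=
  ∀ i, M ∘L leftCreation E i = leftCreation F i ∘L M

/-- The Fourier coefficient `θ_α` of `M ~ ∑ R^α ⊗ θ_α`: `θ_α η` is the coefficient of
`M (e_∅ ⊗ η)` at `e_{ᾱ}`, where `ᾱ` is the reverse of `α`. -/
def fourierCoeff (M : Fock n E →L[ℂ] Fock n F) (α : List (Fin n)) : E →L[ℂ] F :=
  lp.evalCLM ℂ (fun _ : List (Fin n) => F) 2 α.reverse ∘L M ∘L elem []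

/-- `M` is a noncommutative polynomial of degree `m`: its Fourier coefficients vanish at all
words longer than `m`, and do not all vanish at length `m`; the zero polynomial has degree `0`. -/
def IsPolynomialOfDegree (M : Fock n E →L[ℂ] Fock n F) (m : ℕ) : Prop :=
  (∀ β : List (Fin n), m < β.length → fourierCoeff M β = 0) ∧
    (m = 0 ∨ ∃ α : List (Fin n), α.length = m ∧ fourierCoeff M α ≠ 0)

/-- The inclusion of the first summand of a Hilbert space direct sum `E ⊕ F`. -/
def inl (E F : Type*) [NormedAddCommGroup E] [InnerProductSpace ℂ E]
    [NormedAddCommGroup F] [InnerProductSpace ℂ F] : E →L[ℂ] WithLp 2 (E × F) :=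
  ((WithLp.prodContinuousLinearEquiv 2 ℂ E F).symm : E × F →L[ℂ] WithLp 2 (E × F)) ∘L
    ContinuousLinearMap.inl ℂ E F

/-- The inclusion of the second summand of a Hilbert space direct sum `E ⊕ F`. -/
def inr (E F : Type*) [NormedAddCommGroup E] [InnerProductSpace ℂ E]
    [NormedAddCommGroup F] [InnerProductSpace ℂ F] : F →L[ℂ] WithLp 2 (E × F) :=
  ((WithLp.prodContinuousLinearEquiv 2 ℂ E F).symm : E × F →L[ℂ] WithLp 2 (E × F)) ∘L
    ContinuousLinearMap.inr ℂ E F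

/-- The block operator `diag(M, M')` from `Γ ⊗ (E ⊕ E')` to `Γ ⊗ (F ⊕ F')`, under the
identifications `Γ ⊗ (E ⊕ E') = (Γ ⊗ E) ⊕ (Γ ⊗ E')` and the same for `F`, `F'`. -/
def fockDiag (M : Fock n E →L[ℂ] Fock n F) (M' : Fock n E' →L[ℂ] Fock n F') :
    Fock n (WithLp 2 (E × E')) →L[ℂ] Fock n (WithLp 2 (F × F')) :=
  ampl n (inl F F') ∘L M ∘L ampl n (WithLp.fstL 2 ℂ E E') +
    ampl n (inr F F') ∘L M' ∘L ampl n (WithLp.sndL 2 ℂ E E')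

/-- `V* V = I`. -/
def IsIsometry [CompleteSpace E] [CompleteSpace F] (V : E →L[ℂ] F) : Prop := V† ∘L V = 1

/-- `V V* = I`. -/
def IsCoisometry [CompleteSpace E] [CompleteSpace F] (V : E →L[ℂ] F) : Prop := V ∘L V† = 1

theorem leftCreation_elem (i : Fin n) (α : List (Fin n)) (η : E) :
    leftCreation E i (elem α η) = elem (i :: α) η := by
  ext γ
  change shiftFun i (lp.single 2 α η : Fock n E) γ = (lp.single 2 (i :: α) η : Fock n E) γ
  simp only [lp.coeFn_single]
  cases γ with
  | nil => simp [shiftFun]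
  | cons j δ =>
    by_cases h : j = i
    · subst h
      by_cases h' : δ = α
      · subst h'; simp [shiftFun]
      · simp [shiftFun, h']
    · simp [shiftFun, h]

/-- A multi-analytic operator is determined by its Fourier coefficients. -/
theorem IsMultiAnalytic.ext {M M' : Fock n E →L[ℂ] Fock n F} (hM : IsMultiAnalytic M)
    (hM' : IsMultiAnalytic M') (h : ∀ α, fourierCoeff M α = fourierCoeff M' α) : M = M' := by
  have key : ∀ α (η : E), M (elem α η) = M' (elem α η) := by
    intro α η
    induction α with
    | nil =>
      ext γ
      have := congrArg (fun Z => Z η) (h γ.reverse)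
      rw [fourierCoeff, fourierCoeff, List.reverse_reverse] at this
      exact this
    | cons i α ih =>
      rw [← leftCreation_elem]
      have h1 := congrArg (fun Z => Z (elem α η)) (hM i)
      have h2 := congrArg (fun Z => Z (elem α η)) (hM' i)
      simp only [ContinuousLinearMap.comp_apply] at h1 h2
      rw [h1, h2, ih]
  ext1 f
  have hf := lp.hasSum_single (by norm_num : (2 : ℝ≥0∞) ≠ ⊤) f
  have h1 := M.hasSum hf
  have h2 := M'.hasSum hf
  refine h1.unique ?_
  convert h2 using 2 with α
  exact key α (f α)

end Fock

/-! ## The characteristic function of a row contraction -/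

section CharFun

variable {H : Type*} [NormedAddCommGroup H] [InnerProductSpace ℂ H] [CompleteSpace H] {n : ℕ}

/-- `D_{T*}` as an operator from `H` to `𝓓_{T*}`. -/
def defectMap (T : Fin n → H →L[ℂ] H) : H →L[ℂ] DTs T :=
  (defectOp ((rowOp T)†)).codRestrict (DTs T) (defectOp_mem ((rowOp T)†))

/-- The restriction of the row operator of `T` to an operator from `𝓓_T` to `𝓓_{T*}`. -/
def rowRestrict (T : Fin n → H →L[ℂ] H) (hT : IsRowContraction T) : DT T →L[ℂ] DTs T :=
  (rowOp T ∘L (DT T).subtypeL).codRestrict (DTs T) fun x => map_mem_defectSpace hT x.2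

/-- The coefficients of the formal expansion of
`-I ⊗ T + (I ⊗ D_{T*}) (I - R̃ T̃*)⁻¹ R̃ (I ⊗ D_T)` in powers `R^α`, where `R̃ T̃* = ∑ R_i ⊗ T_i*`
and `R̃ = (R_1 ⊗ I, …, R_n ⊗ I)`: the coefficient is `-T|𝓓_T` at the empty word, and
`D_{T*} T_{α₁}* ⋯ T_{αₖ}* P_j D_T|𝓓_T` at the word `α₁ ⋯ αₖ j`, where `P_j : Hⁿ → H` is the
`j`-th coordinate. -/
def charCoeff (T : Fin n → H →L[ℂ] H) (hT : IsRowContraction T) (α : List (Fin n)) :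
    DT T →L[ℂ] DTs T :=
  if h : α = [] then -rowRestrict T hT
  else defectMap T ∘L wordProd (fun i => (T i)†) α.dropLast ∘L
    PiLp.proj 2 (fun _ : Fin n => H) (α.getLast h) ∘L defectOp (rowOp T) ∘L (DT T).subtypeL

/-- The coefficients of `(I - R̃ T̃*)⁻¹ R̃ (I ⊗ D_T) f`, at reversed words. -/
def charState (T : Fin n → H →L[ℂ] H) (f : List (Fin n) → DT T) : List (Fin n) → H
  | [] => 0
  | j :: δ => (defectOp (rowOp T) (f δ.reverse)) j + ((T j)†) (charState T f δ)

theorem charState_add (T : Fin n → H →L[ℂ] H) (f g : List (Fin n) → DT T) (δ : List (Fin n)) :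
    charState T (f + g) δ = charState T f δ + charState T g δ := by
  induction δ with
  | nil => simp [charState]
  | cons j δ ih => simp [charState, ih]; abel

theorem charState_smul (T : Fin n → H →L[ℂ] H) (c : ℂ) (f : List (Fin n) → DT T)
    (δ : List (Fin n)) : charState T (c • f) δ = c • charState T f δ := by
  induction δ with
  | nil => simp [charState]
  | cons j δ ih => simp [charState, ih]

/-- The coefficients of `Θ_T f`. -/
def charOut (T : Fin n → H →L[ℂ] H) (hT : IsRowContraction T) (f : List (Fin n) → DT T)
    (γ : List (Fin n)) : DTs T :=
  -rowRestrict T hT (f γ) + defectMap T (charState T f γ.reverse)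

/-- The finite set of words of length `k`. -/
def wordsOfLength (n : ℕ) : ℕ → Finset (List (Fin n))
  | 0 => {[]}
  | k + 1 => (Finset.univ ×ˢ wordsOfLength n k).map
      ⟨fun p : Fin n × List (Fin n) => p.1 :: p.2, fun p q h => by
        simp only [List.cons.injEq] at h; exact Prod.ext h.1 h.2⟩

theorem mem_wordsOfLength (k : ℕ) (α : List (Fin n)) : α ∈ wordsOfLength n k ↔ α.length = k := by
  induction k generalizing α with
  | zero => simp [wordsOfLength]
  | succ k ih =>
    cases α with
    | nil => simp [wordsOfLength]
    | cons j δ =>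
      simp only [wordsOfLength, Finset.mem_map, Finset.mem_product, Finset.mem_univ, true_and, ih,
        List.length_cons, Nat.add_right_cancel_iff]
      constructor
      · rintro ⟨⟨a, b⟩, h, h'⟩
        have h'' : a :: b = j :: δ := h'
        rw [← (List.cons.inj h'').2]; exact h
      · exact fun h => ⟨(j, δ), h, rfl⟩

theorem charOut_step (T : Fin n → H →L[ℂ] H) (hT : IsRowContraction T)
    (f : List (Fin n) → DT T) (δ : List (Fin n)) :
    ‖charOut T hT f δ.reverse‖ ^ 2 + ∑ j, ‖charState T f (j :: δ)‖ ^ 2 =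
      ‖f δ.reverse‖ ^ 2 + ‖charState T f δ‖ ^ 2 := by
  have h := julia_norm hT (f δ.reverse : PiLp 2 (fun _ : Fin n => H)) (charState T f δ)
  rw [PiLp.norm_sq_eq_of_L2] at h
  simp only [PiLp.add_apply, rowOp_adjoint_apply] at h
  rw [Submodule.coe_norm, Submodule.coe_norm, ← h]
  simp [charOut, charState, rowRestrict, defectMap]
  rfl

theorem charOut_sum (T : Fin n → H →L[ℂ] H) (hT : IsRowContraction T)
    (f : List (Fin n) → DT T) (k : ℕ) :
    ∑ i ∈ Finset.range k, ∑ δ ∈ wordsOfLength n i, ‖charOut T hT f δ.reverse‖ ^ 2 +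
        ∑ δ ∈ wordsOfLength n k, ‖charState T f δ‖ ^ 2 =
      ∑ i ∈ Finset.range k, ∑ δ ∈ wordsOfLength n i, ‖f δ.reverse‖ ^ 2 := by
  induction k with
  | zero => simp [wordsOfLength, charState]
  | succ k ih =>
    rw [Finset.sum_range_succ, Finset.sum_range_succ, ← ih]
    have h1 : ∑ δ ∈ wordsOfLength n (k + 1), ‖charState T f δ‖ ^ 2 =
        ∑ δ ∈ wordsOfLength n k, ∑ j, ‖charState T f (j :: δ)‖ ^ 2 := by
      rw [wordsOfLength, Finset.sum_map, Finset.sum_product_right]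
      rfl
    have h2 := Finset.sum_congr (s₁ := wordsOfLength n k) rfl
      (fun δ _ => charOut_step T hT f δ)
    rw [Finset.sum_add_distrib, Finset.sum_add_distrib] at h2
    rw [h1]
    linarith

theorem charOut_sum_le (T : Fin n → H →L[ℂ] H) (hT : IsRowContraction T)
    (f : Fock n (DT T)) (s : Finset (List (Fin n))) :
    ∑ γ ∈ s, ‖charOut T hT f γ‖ ^ (2 : ℝ≥0∞).toReal ≤ ‖f‖ ^ (2 : ℝ≥0∞).toReal := by
  classical
  let rev : List (Fin n) ↪ List (Fin n) := ⟨List.reverse, List.reverse_injective⟩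
  obtain ⟨k, hk⟩ : ∃ k, ∀ γ ∈ s, γ.length < k :=
    ⟨s.sup List.length + 1, fun γ hγ => Nat.lt_succ_of_le (Finset.le_sup (f := List.length) hγ)⟩
  have hdisj : ((Finset.range k : Finset ℕ) : Set ℕ).PairwiseDisjoint (wordsOfLength n) := by
    intro i _ j _ hij
    refine Finset.disjoint_left.2 fun α h1 h2 => hij ?_
    rw [mem_wordsOfLength] at h1 h2
    omega
  let t : Finset (List (Fin n)) := ((Finset.range k).biUnion (wordsOfLength n)).map rev
  have hst : s ⊆ t := by
    intro γ hγ
    refine Finset.mem_map.2 ⟨γ.reverse, ?_, List.reverse_reverse γ⟩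
    refine Finset.mem_biUnion.2 ⟨γ.length, Finset.mem_range.2 (hk γ hγ), ?_⟩
    rw [mem_wordsOfLength, List.length_reverse]
  have hsum : ∀ F : List (Fin n) → ℝ, ∑ γ ∈ t, F γ =
      ∑ i ∈ Finset.range k, ∑ δ ∈ wordsOfLength n i, F δ.reverse := by
    intro F
    rw [Finset.sum_map, Finset.sum_biUnion hdisj]
    rfl
  have h2 : ∑ γ ∈ t, ‖f γ‖ ^ (2 : ℝ≥0∞).toReal ≤ ‖f‖ ^ (2 : ℝ≥0∞).toReal :=
    lp.sum_rpow_le_norm_rpow (by norm_num) f t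
  have hnn : ∀ γ, 0 ≤ ‖charOut T hT f γ‖ ^ (2 : ℝ≥0∞).toReal := fun γ => by positivity
  refine (Finset.sum_le_sum_of_subset_of_nonneg hst fun γ _ _ => hnn γ).trans (le_trans ?_ h2)
  rw [hsum, hsum]
  have h3 := charOut_sum T hT f k
  have h4 : 0 ≤ ∑ δ ∈ wordsOfLength n k, ‖charState T f δ‖ ^ 2 :=
    Finset.sum_nonneg fun _ _ => by positivity
  simp only [ENNReal.toReal_ofNat, Real.rpow_ofNat]
  linarith

/-- The operator with the coefficients `charOut`. -/
def charOp (T : Fin n → H →L[ℂ] H) (hT : IsRowContraction T) :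
    Fock n (DT T) →L[ℂ] Fock n (DTs T) :=
  LinearMap.mkContinuous
    { toFun f := ⟨charOut T hT f, memℓp_gen' (charOut_sum_le T hT f)⟩
      map_add' f g := by
        ext1
        funext γ
        change charOut T hT (f + g : Fock n (DT T)) γ = charOut T hT f γ + charOut T hT g γ
        have h := charState_add T f g γ.reverse
        simp only [charOut, lp.coeFn_add, Pi.add_apply, h, map_add]
        abel
      map_smul' c f := by
        ext γ
        simp [charOut, charState_smul] } 1
    fun f => by
      rw [one_mul]
      exact lp.norm_le_of_forall_sum_le (by norm_num) (norm_nonneg _) (charOut_sum_le T hT f)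

theorem charState_shift (T : Fin n → H →L[ℂ] H) (f : List (Fin n) → DT T) (i j : Fin n)
    (δ : List (Fin n)) :
    charState T (shiftFun i f) (δ ++ [j]) = if j = i then charState T f δ else 0 := by
  induction δ with
  | nil => simp [charState, shiftFun]
  | cons l δ ih =>
    by_cases h : j = i
    · subst h
      simp only [if_true] at ih
      simp [charState, shiftFun, ih]
    · simp only [h, if_false] at ih
      simp [charState, shiftFun, ih, h]

theorem charOp_multiAnalytic (T : Fin n → H →L[ℂ] H) (hT : IsRowContraction T) :
    IsMultiAnalytic (charOp T hT) := by
  intro i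
  ext1 f
  ext1
  funext γ
  change charOut T hT (shiftFun i f) γ = shiftFun i (charOut T hT f) γ
  cases γ with
  | nil => simp [charOut, shiftFun, charState]
  | cons j δ =>
    by_cases h : j = i <;> simp [charOut, shiftFun, charState_shift, h]

theorem charState_elem (T : Fin n → H →L[ℂ] H) (η : DT T) (δ : List (Fin n)) (j : Fin n) :
    charState T (elem [] η : Fock n (DT T)) (δ ++ [j]) =
      wordProd (fun i => (T i)†) δ ((defectOp (rowOp T) η) j) := by
  induction δ with
  | nil => simp [charState, elem, wordProd]
  | cons l δ ih =>
    rw [List.cons_append, charState, ih]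
    simp [elem, wordProd]

theorem charOp_coeff (T : Fin n → H →L[ℂ] H) (hT : IsRowContraction T) (α : List (Fin n)) :
    fourierCoeff (charOp T hT) α = charCoeff T hT α := by
  ext1 η
  change charOut T hT (elem [] η : Fock n (DT T)) α.reverse = _
  rcases List.eq_nil_or_concat α with rfl | ⟨δ, j, rfl⟩
  · simp [charOut, charCoeff, charState, elem]
  · rw [List.concat_eq_append, charOut, List.reverse_reverse, charState_elem]
    simp [charCoeff, elem]

/-- There is exactly one multi-analytic operator with the Fourier coefficients `charCoeff`. -/
theorem existsUnique_charFun (T : Fin n → H →L[ℂ] H) (hT : IsRowContraction T) :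
    ∃! Θ : Fock n (DT T) →L[ℂ] Fock n (DTs T),
      IsMultiAnalytic Θ ∧ ∀ α, fourierCoeff Θ α = charCoeff T hT α :=
  ⟨charOp T hT, ⟨charOp_multiAnalytic T hT, charOp_coeff T hT⟩, fun _ h =>
    h.1.ext (charOp_multiAnalytic T hT) fun α => (h.2 α).trans (charOp_coeff T hT α).symm⟩

/-- The characteristic function `Θ_T : Γ ⊗ 𝓓_T → Γ ⊗ 𝓓_{T*}` of a row contraction `T`: the
multi-analytic operator with
`Θ_T ~ -I ⊗ T + (I ⊗ D_{T*}) (I - R̃ T̃*)⁻¹ R̃ (I ⊗ D_T)`. -/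
def charFun (T : Fin n → H →L[ℂ] H) (hT : IsRowContraction T) :
    Fock n (DT T) →L[ℂ] Fock n (DTs T) :=
  (existsUnique_charFun T hT).choose

end CharFun

end

end RowOperators

namespace RowOperators

noncomputable section

/-! ## Constant and multi-analytic operators -/

section Fock

variable {n : ℕ} {E F G E' F' : Type*} [NormedAddCommGroup E] [InnerProductSpace ℂ E]
  [NormedAddCommGroup F] [InnerProductSpace ℂ F] [NormedAddCommGroup G] [InnerProductSpace ℂ G]
  [NormedAddCommGroup E'] [InnerProductSpace ℂ E']
  [NormedAddCommGroup F'] [InnerProductSpace ℂ F']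

/-! The Julia operator `J (x, y) = (-T x + D_{T*} y, D_T x + T* y)` is unitary, and its transfer
function is `Θ_T`: the input enters through `𝓓_T`, the state moves by the `T_i*`, and the output is
read through `D_{T*}`.

Let `K_k` be the space of `x` with `D_{T*} T_{δ₁}* ⋯ T_{δₗ}* x = 0` for all words `δ` of length at
least `k`. If the coefficients vanish beyond degree `m`, the components of `D_T u` lie in `K_m`.
Both `K_0 ⊆ K_m` are invariant under all `T_i*`, and `m` applications carry `K_m` into `K_0`, on
which `D_{T*}` vanishes. So the compression `N` of `T` to `M = K_m ⊖ K_0` is nilpotent, and modulo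
`K_0` the words in `N_i*` act on `K_m` as those in `T_i*`. Replacing the state operators of the
colligation by `N_i*` therefore leaves all coefficients of `Θ_T` unchanged
(`defectMap_wordProd_compression`).

It remains to pass from this compressed colligation to `Θ_N`. With `R` the row operator of `N`, what
`J†` and `J` send outside the state space factors through `D_R` and `D_{R*}` by isometries `W` and
`V` (`exists_isometry_of_compression`). The constants are `V₁ = p (V, (1 - V V†) J)` and the column
`V₂` of `W†` and `1 - W W†`, restricted to the inputs. The second entries carry the part of the
input not seen by `N`, which is the identity summand (`exists_factorization_of_compression`). -/

@[simp] theorem ampl_apply (V : E →L[ℂ] F) (f : Fock n E) (α : List (Fin n)) :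
    ampl n V f α = V (f α) := rfl

@[simp] theorem elem_nil_apply (η : E) (α : List (Fin n)) :
    (elem [] η : Fock n E) α = if α = [] then η else 0 := by
  change (lp.single 2 [] η : Fock n E) α = _
  by_cases h : α = []
  · subst h; simp
  · simp [h]

theorem ampl_elem (V : E →L[ℂ] F) (η : E) :
    ampl n V (elem [] η) = elem [] (V η) := by
  ext α
  by_cases h : α = [] <;> simp [h]

theorem ampl_comp (W : F →L[ℂ] G) (V : E →L[ℂ] F) :
    ampl n (W ∘L V) = ampl n W ∘L ampl n V := rfl

theorem ampl_one : ampl n (1 : E →L[ℂ] E) = 1 := rfl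

/-- The inner product of the Fock space is the sum over words, so the adjoint may be taken
coefficientwise. This is what transfers isometry and coisometry from `V` to `I_Γ ⊗ V`. -/
theorem ampl_adjoint [CompleteSpace E] [CompleteSpace F] (V : E →L[ℂ] F) :
    (ampl n V)† = ampl n (V†) := by
  symm
  rw [ContinuousLinearMap.eq_adjoint_iff]
  intro f g
  simp [lp.inner_eq_tsum, ContinuousLinearMap.adjoint_inner_left]

theorem IsIsometry.ampl [CompleteSpace E] [CompleteSpace F] {V : E →L[ℂ] F} (hV : IsIsometry V) :
    IsIsometry (ampl n V) := by
  rw [IsIsometry, ampl_adjoint, ← ampl_comp, hV, ampl_one]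

theorem IsCoisometry.ampl [CompleteSpace E] [CompleteSpace F] {V : E →L[ℂ] F}
    (hV : IsCoisometry V) : IsCoisometry (ampl n V) := by
  rw [IsCoisometry, ampl_adjoint, ← ampl_comp, hV, ampl_one]

theorem ampl_leftCreation (V : E →L[ℂ] F) (i : Fin n) (f : Fock n E) :
    ampl n V (leftCreation E i f) = leftCreation F i (ampl n V f) := by
  ext γ
  change V (shiftFun i f γ) = shiftFun i (ampl n V f) γ
  cases γ with
  | nil => simp [shiftFun]
  | cons j δ => by_cases h : j = i <;> simp [shiftFun, h]

theorem isMultiAnalytic_ampl (V : E →L[ℂ] F) : IsMultiAnalytic (ampl n V) := fun i => by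
  ext1 f
  exact ampl_leftCreation V i f

theorem isMultiAnalytic_one : IsMultiAnalytic (1 : Fock n E →L[ℂ] Fock n E) := fun i => by
  ext1 f
  rfl

theorem IsMultiAnalytic.comp {M : Fock n F →L[ℂ] Fock n G} {M' : Fock n E →L[ℂ] Fock n F}
    (hM : IsMultiAnalytic M) (hM' : IsMultiAnalytic M') : IsMultiAnalytic (M ∘L M') := fun i => by
  ext1 f
  have h := congrArg (fun Z => Z f) (hM' i)
  have h' := congrArg (fun Z => Z (M' f)) (hM i)
  simp only [ContinuousLinearMap.comp_apply] at h h' ⊢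
  rw [h, h']

theorem IsMultiAnalytic.add {M M' : Fock n E →L[ℂ] Fock n F}
    (hM : IsMultiAnalytic M) (hM' : IsMultiAnalytic M') : IsMultiAnalytic (M + M') := fun i => by
  ext1 f
  have h := congrArg (fun Z => Z f) (hM i)
  have h' := congrArg (fun Z => Z f) (hM' i)
  simp only [ContinuousLinearMap.comp_apply] at h h'
  simp only [ContinuousLinearMap.comp_apply, add_apply, map_add, h, h']

theorem IsMultiAnalytic.fockDiag {M : Fock n E →L[ℂ] Fock n F} {M' : Fock n E' →L[ℂ] Fock n F'}
    (hM : IsMultiAnalytic M) (hM' : IsMultiAnalytic M') :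
    IsMultiAnalytic (fockDiag (E := E) (F := F) (E' := E') (F' := F') M M') :=
  ((isMultiAnalytic_ampl _).comp (hM.comp (isMultiAnalytic_ampl _))).add
    ((isMultiAnalytic_ampl _).comp (hM'.comp (isMultiAnalytic_ampl _)))

theorem fourierCoeff_apply (M : Fock n E →L[ℂ] Fock n F) (α : List (Fin n)) (η : E) :
    fourierCoeff M α η = M (elem [] η) α.reverse := rfl

theorem fourierCoeff_ampl_comp (V : F →L[ℂ] G) (M : Fock n E →L[ℂ] Fock n F)
    (α : List (Fin n)) : fourierCoeff (ampl n V ∘L M) α = V ∘L fourierCoeff M α := rfl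

theorem fourierCoeff_comp_ampl (V : E →L[ℂ] F) (M : Fock n F →L[ℂ] Fock n G)
    (α : List (Fin n)) : fourierCoeff (M ∘L ampl n V) α = fourierCoeff M α ∘L V := by
  ext η
  simp [fourierCoeff_apply, ampl_elem]

theorem fourierCoeff_add (M M' : Fock n E →L[ℂ] Fock n F) (α : List (Fin n)) :
    fourierCoeff (M + M') α = fourierCoeff M α + fourierCoeff M' α := by
  ext1 η
  rfl

theorem fourierCoeff_one (α : List (Fin n)) (η : E) :
    fourierCoeff (1 : Fock n E →L[ℂ] Fock n E) α η = if α = [] then η else 0 := by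
  simp [fourierCoeff_apply]

theorem fourierCoeff_fockDiag_apply (M : Fock n E →L[ℂ] Fock n F)
    (M' : Fock n E' →L[ℂ] Fock n F') (α : List (Fin n)) (x : WithLp 2 (E × E')) :
    fourierCoeff (fockDiag (E := E) (F := F) (E' := E') (F' := F') M M') α x =
      WithLp.toLp 2 (fourierCoeff M α x.fst, fourierCoeff M' α x.snd) := by
  rw [fockDiag, fourierCoeff_add, fourierCoeff_ampl_comp, fourierCoeff_ampl_comp,
    fourierCoeff_comp_ampl, fourierCoeff_comp_ampl]
  apply WithLp.ofLp_injective
  simp [inl, inr]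

end Fock

/-! ### Coefficients of the characteristic function and word products. -/

section CharFun

variable {H : Type*} [NormedAddCommGroup H] [InnerProductSpace ℂ H] [CompleteSpace H] {n : ℕ}

theorem charFun_isMultiAnalytic (T : Fin n → H →L[ℂ] H) (hT : IsRowContraction T) :
    IsMultiAnalytic (charFun T hT) := (existsUnique_charFun T hT).choose_spec.1.1

theorem fourierCoeff_charFun (T : Fin n → H →L[ℂ] H) (hT : IsRowContraction T)
    (α : List (Fin n)) : fourierCoeff (charFun T hT) α = charCoeff T hT α :=
  (existsUnique_charFun T hT).choose_spec.1.2 α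

theorem charCoeff_nil (T : Fin n → H →L[ℂ] H) (hT : IsRowContraction T) :
    charCoeff T hT [] = -rowRestrict T hT := by simp [charCoeff]

theorem charCoeff_append (T : Fin n → H →L[ℂ] H) (hT : IsRowContraction T) (α : List (Fin n))
    (j : Fin n) (η : DT T) :
    charCoeff T hT (α ++ [j]) η =
      defectMap T (wordProd (fun i => (T i)†) α (defectOp (rowOp T) η j)) := by
  simp [charCoeff]

theorem wordProd_cons (T : Fin n → H →L[ℂ] H) (i : Fin n) (α : List (Fin n)) (x : H) :
    wordProd T (i :: α) x = T i (wordProd T α x) := by simp [wordProd]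

theorem wordProd_append (T : Fin n → H →L[ℂ] H) (α β : List (Fin n)) (x : H) :
    wordProd T (α ++ β) x = wordProd T α (wordProd T β x) := by simp [wordProd]

/-- Adjoints reverse products. The reversal is harmless for nilpotency, which concerns all words of
a given length. -/
theorem wordProd_adjoint (T : Fin n → H →L[ℂ] H) (α : List (Fin n)) :
    (wordProd T α)† = wordProd (fun i => (T i)†) α.reverse := by
  rw [← ContinuousLinearMap.star_eq_adjoint]
  simp only [wordProd, List.map_reverse, ← ContinuousLinearMap.star_eq_adjoint]
  induction α with
  | nil => simp
  | cons i α ih => simp [ih]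

end CharFun

/-! ## Operators on defect spaces -/

section Defect

variable {H K F : Type*} [NormedAddCommGroup H] [InnerProductSpace ℂ H] [CompleteSpace H]
  [NormedAddCommGroup K] [InnerProductSpace ℂ K] [CompleteSpace K]
  [NormedAddCommGroup F] [InnerProductSpace ℂ F] [CompleteSpace F]

/-- `D_A` as an operator to `𝓓_A`. -/
def defectCorestrict (A : H →L[ℂ] K) : H →L[ℂ] defectSpace A :=
  (defectOp A).codRestrict (defectSpace A) (defectOp_mem A)

@[simp] theorem coe_defectCorestrict (A : H →L[ℂ] K) (x : H) :
    (defectCorestrict A x : H) = defectOp A x := rfl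

theorem denseRange_defectCorestrict (A : H →L[ℂ] K) : DenseRange (defectCorestrict A) := by
  intro y
  rw [closure_subtype]
  have h : ((↑) : defectSpace A → H) '' Set.range (defectCorestrict A) =
      (LinearMap.range (defectOp A).toLinearMap : Set H) := by
    ext z
    simp
  rw [h]
  exact y.2

/-- The vectors `D_A x` are dense in `𝓓_A`, so identities between bounded operators there need
checking only on them. -/
theorem defectSpace_ext {A : H →L[ℂ] K} {S S' : defectSpace A →L[ℂ] F}
    (h : ∀ x, S (defectCorestrict A x) = S' (defectCorestrict A x)) : S = S' :=
  DFunLike.coe_injective ((denseRange_defectCorestrict A).equalizer S.continuous S'.continuous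
    (funext h))

theorem inner_defectOp_left (A : H →L[ℂ] K) (x y : H) :
    inner ℂ (defectOp A x) y = inner ℂ x (defectOp A y) := by
  conv_lhs => rw [← defectOp_adjoint, ContinuousLinearMap.adjoint_inner_left]

/-- `D_A` is injective on `𝓓_A`. -/
theorem eq_zero_of_defectOp_eq_zero {A : H →L[ℂ] K} (η : defectSpace A)
    (h : defectOp A η = 0) : η = 0 := by
  -- As `D_A` is self-adjoint, a vector of its kernel is orthogonal to its range, hence to `𝓓_A`,
  -- hence to itself.
  have h0 : innerSL ℂ η = 0 := defectSpace_ext fun x => by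
    change inner ℂ (η : H) (defectOp A x) = 0
    rw [← inner_defectOp_left, h, inner_zero_left]
  have h1 := congrArg (fun φ => φ η) h0
  exact inner_self_eq_zero.1 (h1 : inner ℂ η η = 0)

theorem isIsometry_of_norm_eq {V : H →L[ℂ] K} (h : ∀ x, ‖V x‖ = ‖x‖) : IsIsometry V :=
  (ContinuousLinearMap.norm_map_iff_adjoint_comp_self V).1 h

theorem IsIsometry.adjoint_apply {V : H →L[ℂ] K} (h : IsIsometry V) (x : H) : (V†) (V x) = x :=
  congrArg (fun Z => Z x) h

theorem IsIsometry.norm_map {V : H →L[ℂ] K} (h : IsIsometry V) (x : H) : ‖V x‖ = ‖x‖ :=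
  (ContinuousLinearMap.norm_map_iff_adjoint_comp_self V).2 h x

/-- If `‖f x‖ = ‖D_A x‖` for all `x`, then `f = V D_A` with an isometry `V` on `𝓓_A`. -/
theorem exists_isometry_comp_defectOp (A : H →L[ℂ] K) (f : H →L[ℂ] F)
    (h : ∀ x, ‖f x‖ = ‖defectOp A x‖) :
    ∃ V : defectSpace A →L[ℂ] F, IsIsometry V ∧ ∀ x, V (defectCorestrict A x) = f x := by
  -- The extension by density is meaningful because `‖f y‖ ≤ 1 * ‖D_A y‖`; this bound also makes `f`
  -- well defined on the range of `D_A`.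
  have hV : ∀ x, f.toLinearMap.extendOfNorm (defectCorestrict A).toLinearMap
      (defectCorestrict A x) = f x := fun x =>
    LinearMap.extendOfNorm_eq (f := f.toLinearMap) (e := (defectCorestrict A).toLinearMap)
      (denseRange_defectCorestrict A) ⟨1, fun y => by rw [one_mul]; exact (h y).le⟩ x
  refine ⟨_, isIsometry_of_norm_eq fun η => ?_, hV⟩
  set V := f.toLinearMap.extendOfNorm (defectCorestrict A).toLinearMap
  refine congrFun ((denseRange_defectCorestrict A).equalizer V.continuous.norm continuous_norm
    (funext fun x => ?_)) η
  change ‖V (defectCorestrict A x)‖ = _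
  rw [hV, h]
  rfl

end Defect

/-! ### Compressed unitary colligations and their factorization. -/

section Compression

variable {A B X X' U Y : Type*} [NormedAddCommGroup A] [InnerProductSpace ℂ A] [CompleteSpace A]
  [NormedAddCommGroup B] [InnerProductSpace ℂ B] [CompleteSpace B]
  [NormedAddCommGroup X] [InnerProductSpace ℂ X] [CompleteSpace X]
  [NormedAddCommGroup X'] [InnerProductSpace ℂ X'] [CompleteSpace X']
  [NormedAddCommGroup U] [InnerProductSpace ℂ U] [CompleteSpace U]
  [NormedAddCommGroup Y] [InnerProductSpace ℂ Y] [CompleteSpace Y]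

/-- For a contraction `R = i† J i'` compressed from an isometry `J`, the part of `J i'` off the
range of `i` factors isometrically through `D_R`. -/
theorem exists_isometry_of_compression {J : B →L[ℂ] A} (hJ : IsIsometry J) {i : X →L[ℂ] A}
    (hi : IsIsometry i) {i' : X' →L[ℂ] B} (hi' : IsIsometry i') {R : X' →L[ℂ] X}
    (hR : ‖R‖ ≤ 1) (hRJ : ∀ x, (i†) (J (i' x)) = R x) :
    ∃ W : defectSpace R →L[ℂ] A, IsIsometry W ∧
      (∀ x, W (defectCorestrict R x) = J (i' x) - i (R x)) ∧ (∀ η, (i†) (W η) = 0) ∧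
      ∀ a, defectOp R ((W†) a) = (i'†) ((J†) a) - (R†) ((i†) a) := by
  have h0 : ∀ x, (i†) (J (i' x) - i (R x)) = 0 := fun x => by
    rw [map_sub, hRJ, hi.adjoint_apply, sub_self]
  have hn : ∀ x, ‖(J ∘L i' - i ∘L R) x‖ = ‖defectOp R x‖ := by
    intro x
    rw [← sq_eq_sq₀ (norm_nonneg _) (norm_nonneg _), norm_sq_defectOp hR, eq_sub_iff_add_eq,
      ← hi.norm_map (R x), ← hi'.norm_map x, ← hJ.norm_map (i' x)]
    -- Since `i (R x)` is the projection of `J (i' x)` to the range of `i`, Pythagoras gives the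
    -- remainder the squared norm `‖x‖² - ‖R x‖² = ‖D_R x‖²`.
    have h1 : inner ℂ (J (i' x) - i (R x)) (i (R x)) = 0 := by
      rw [← ContinuousLinearMap.adjoint_inner_left, h0, inner_zero_left]
    have h2 := norm_add_sq_eq_norm_sq_add_norm_sq_of_inner_eq_zero _ _ h1
    rw [sub_add_cancel] at h2
    simp only [sq]
    exact h2.symm
  obtain ⟨W, hW, hWD⟩ := exists_isometry_comp_defectOp R _ hn
  refine ⟨W, hW, hWD, fun η => ?_, fun a => ?_⟩
  swap
  · refine ext_inner_right ℂ fun y => ?_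
    have e : inner ℂ (defectOp R ((W†) a)) y = inner ℂ a (W (defectCorestrict R y)) := by
      rw [inner_defectOp_left]
      exact ContinuousLinearMap.adjoint_inner_left W (defectCorestrict R y) a
    rw [e, hWD, sub_apply, ContinuousLinearMap.comp_apply, ContinuousLinearMap.comp_apply,
      inner_sub_right, inner_sub_left]
    simp only [ContinuousLinearMap.adjoint_inner_left]
  have h2 : i† ∘L W = 0 := defectSpace_ext fun x => by
    rw [ContinuousLinearMap.comp_apply, hWD]
    exact h0 x
  exact congrArg (fun Z => Z η) h2

/-- For an isometry `V` into the space of a unitary operator `J`, the row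
`(V, (1 - V V†) J)` is a coisometry, and so are its compositions with coisometries. -/
theorem exists_coisometry_row {D : Type*} [NormedAddCommGroup D] [InnerProductSpace ℂ D]
    [CompleteSpace D] {J : A →L[ℂ] B} (hJ : IsCoisometry J) {V : D →L[ℂ] B} (hV : IsIsometry V)
    {p : B →L[ℂ] Y} (hp : IsCoisometry p) :
    ∃ V₁ : WithLp 2 (D × A) →L[ℂ] Y, IsCoisometry V₁ ∧
      ∀ η a, V₁ (WithLp.toLp 2 (η, a)) = p (V η + (J a - V ((V†) (J a)))) := by
  let V₁ : WithLp 2 (D × A) →L[ℂ] Y :=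
    p ∘L (V ∘L WithLp.fstL 2 ℂ D A + (1 - V ∘L V†) ∘L J ∘L WithLp.sndL 2 ℂ D A)
  -- The adjoint of the row, computed entrywise; the projection `1 - V V†` is self-adjoint.
  let S : Y →L[ℂ] WithLp 2 (D × A) :=
    ((WithLp.prodContinuousLinearEquiv 2 ℂ D A).symm : D × A →L[ℂ] WithLp 2 (D × A)) ∘L
      ((V† ∘L p†).prod (J† ∘L (1 - V ∘L V†) ∘L p†))
  have hV₁ : ∀ η a, V₁ (WithLp.toLp 2 (η, a)) = p (V η + (J a - V ((V†) (J a)))) :=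
    fun η a => rfl
  have hS : ∀ y, S y = WithLp.toLp 2
      ((V†) ((p†) y), (J†) ((p†) y - V ((V†) ((p†) y)))) := fun y => rfl
  have hadj : V₁† = S := by
    symm
    rw [ContinuousLinearMap.eq_adjoint_iff]
    rintro y ⟨η, a⟩
    rw [hV₁, hS, WithLp.prod_inner_apply, ← ContinuousLinearMap.adjoint_inner_left p]
    simp only [ContinuousLinearMap.adjoint_inner_left, inner_add_right, inner_sub_right,
      inner_sub_left]
    rw [← ContinuousLinearMap.adjoint_inner_right V,
      ContinuousLinearMap.adjoint_inner_left V ((V†) (J a)),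
      ContinuousLinearMap.adjoint_inner_left p (V _)]
  refine ⟨V₁, ?_, hV₁⟩
  rw [IsCoisometry, hadj]
  ext1 y
  have hpp : p ((p†) y) = y := congrArg (fun Z => Z y) hp
  have hJJ : ∀ b, J ((J†) b) = b := fun b => congrArg (fun Z => Z b) hJ
  -- With `J J† = 1` the product is `p (V V† + (1 - V V†)²) p† = p p† = 1`.
  simp only [ContinuousLinearMap.comp_apply, hS, hV₁, hJJ, map_sub, hV.adjoint_apply, sub_self,
    map_zero, sub_zero, add_sub_cancel, one_apply_eq_self, hpp]

/-- For an isometry `W`, the column of `W†` and `1 - W W†` is an isometry, and so are its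
compositions with isometries. -/
theorem exists_isometry_column {D : Type*} [NormedAddCommGroup D] [InnerProductSpace ℂ D]
    [CompleteSpace D] {W : D →L[ℂ] A} (hW : IsIsometry W) {ι : U →L[ℂ] A} (hι : IsIsometry ι) :
    ∃ V₂ : U →L[ℂ] WithLp 2 (D × A), IsIsometry V₂ ∧
      ∀ u, V₂ u = WithLp.toLp 2 ((W†) (ι u), ι u - W ((W†) (ι u))) := by
  refine ⟨((WithLp.prodContinuousLinearEquiv 2 ℂ D A).symm : D × A →L[ℂ] WithLp 2 (D × A)) ∘L
    ((W† ∘L ι).prod ((1 - W ∘L W†) ∘L ι)), isIsometry_of_norm_eq fun u => ?_, fun u => rfl⟩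
  change ‖WithLp.toLp 2 ((W†) (ι u), ι u - W ((W†) (ι u)))‖ = _
  rw [← sq_eq_sq₀ (norm_nonneg _) (norm_nonneg _), WithLp.prod_norm_sq_eq_of_L2, ← hι.norm_map u]
  -- The two entries of the column are the components of `ι u` in the range of `W` and in its
  -- orthogonal complement.
  have h1 : inner ℂ (W ((W†) (ι u))) (ι u - W ((W†) (ι u))) = 0 := by
    rw [← ContinuousLinearMap.adjoint_inner_right, map_sub, hW.adjoint_apply, sub_self,
      inner_zero_right]
  have h2 := norm_add_sq_eq_norm_sq_add_norm_sq_of_inner_eq_zero _ _ h1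
  rw [add_sub_cancel, hW.norm_map] at h2
  simp only [sq]
  exact h2.symm

/-- A compression of a unitary colligation `J` whose state operator is `R†` factors through the
Julia operator of `R`. -/
theorem exists_factorization_of_compression {J : A →L[ℂ] B} (hJ : IsIsometry J)
    (hJ' : IsIsometry (J†)) {i : X →L[ℂ] A} (hi : IsIsometry i) {i' : X' →L[ℂ] B}
    (hi' : IsIsometry i') {ι : U →L[ℂ] A} (hι : IsIsometry ι) (hiι : ∀ u, (i†) (ι u) = 0)
    {p : B →L[ℂ] Y} (hp : IsCoisometry p) (hpi : ∀ x, p (i' x) = 0) {R : X' →L[ℂ] X}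
    (hR : ‖R‖ ≤ 1) (hRJ : ∀ x, (i†) ((J†) (i' x)) = R x) :
    ∃ (V₁ : WithLp 2 (defectSpace (R†) × A) →L[ℂ] Y)
      (V₂ : U →L[ℂ] WithLp 2 (defectSpace R × A)),
      IsCoisometry V₁ ∧ IsIsometry V₂ ∧
      (∀ u, V₁ (WithLp.toLp 2
        (-⟨R (V₂ u).fst, map_mem_defectSpace hR (V₂ u).fst.2⟩, (V₂ u).snd)) = p (J (ι u))) ∧
      (∀ u, defectOp R (V₂ u).fst = (i'†) (J (ι u))) ∧
      ∀ x, V₁ (WithLp.toLp 2 (defectCorestrict (R†) x, 0)) = p (J (i x)) := by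
  have hRJ' : ∀ x, (i'†) (J (i x)) = (R†) x := fun x => by
    refine ext_inner_right ℂ fun y => ?_
    simp only [ContinuousLinearMap.adjoint_inner_left, ← hRJ]
    simp only [← ContinuousLinearMap.adjoint_inner_left, ContinuousLinearMap.adjoint_adjoint]
  -- The same construction is used twice: on `J`, compressed to `R†`, it gives `V`; on `J†`,
  -- compressed to `R`, it gives `W`.
  obtain ⟨V, hV, hVD, hVi, hVa⟩ :=
    exists_isometry_of_compression hJ hi' hi (norm_adjoint_le_one hR) hRJ'
  obtain ⟨W, hW, hWD, hWi, hWa⟩ := exists_isometry_of_compression hJ' hi hi' hR hRJ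
  have hJJ : ∀ b, J ((J†) b) = b := fun b => by
    have := hJ'.adjoint_apply b
    rwa [ContinuousLinearMap.adjoint_adjoint] at this
  have hVi' : ∀ x, (V†) (i' x) = 0 := fun x => by
    refine ext_inner_right ℂ fun y => ?_
    rw [ContinuousLinearMap.adjoint_inner_left, ← ContinuousLinearMap.adjoint_inner_right, hVi]
    simp
  -- The restriction of `R` to the defect spaces.
  let R₀ : defectSpace R →L[ℂ] defectSpace (R†) :=
    (R ∘L (defectSpace R).subtypeL).codRestrict _ fun x => map_mem_defectSpace hR x.2
  -- On `η = D_R x` this reads `J (J† i' x - i R x) = i' (x - R† R x) - V (D_{R*} R x)`, which is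
  -- the claim because `D_R² = 1 - R† R` and `D_{R*} R = R D_R`.
  have hJW : ∀ η, J (W η) = i' (defectOp R η) - V (R₀ η) := by
    have h : J ∘L W = i' ∘L defectOp R ∘L (defectSpace R).subtypeL - V ∘L R₀ := by
      refine defectSpace_ext fun x => ?_
      have e1 : R₀ (defectCorestrict R x) = defectCorestrict (R†) (R x) :=
        Subtype.ext (defectOp_intertwine hR x)
      have e2 := congrArg (fun Z => Z x) (defectOp_sq hR)
      simp only [ContinuousLinearMap.comp_apply, sub_apply, one_apply_eq_self] at e2
      simp only [ContinuousLinearMap.comp_apply, sub_apply, hWD, e1, hVD, map_sub, hJJ,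
        Submodule.subtypeL_apply, coe_defectCorestrict, e2]
      abel
    exact fun η => congrArg (fun Z => Z η) h
  have hDW : ∀ u, defectOp R ((W†) (ι u)) = (i'†) (J (ι u)) := fun u => by
    rw [hWa, hiι, map_zero, sub_zero, ContinuousLinearMap.adjoint_adjoint]
  -- Injectivity of `D_{R*}` on its defect space reduces this to `D_{R*} V† J ι u = -R i'† J ι u =
  -- -R D_R W† ι u`, using `i† ι = 0`.
  have hVJ : ∀ u, (V†) (J (ι u)) = -R₀ ((W†) (ι u)) := fun u => by
    rw [eq_neg_iff_add_eq_zero]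
    apply eq_zero_of_defectOp_eq_zero
    have e : defectOp (R†) (R₀ ((W†) (ι u)) : X) = R (defectOp R ((W†) (ι u))) :=
      (defectOp_intertwine hR _).symm
    rw [Submodule.coe_add, map_add, e, hDW, hVa, hJ.adjoint_apply, hiι, zero_sub,
      ContinuousLinearMap.adjoint_adjoint, neg_add_cancel]
  have hJc : IsCoisometry J := by ext1 b; exact hJJ b
  obtain ⟨V₁, hV₁c, hV₁⟩ := exists_coisometry_row hJc hV hp
  obtain ⟨V₂, hV₂i, hV₂⟩ := exists_isometry_column hW hι
  refine ⟨V₁, V₂, hV₁c, hV₂i, fun u => ?_, fun u => ?_, fun x => ?_⟩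
  · rw [hV₂]
    have e : (⟨R ((W†) (ι u)), map_mem_defectSpace hR ((W†) (ι u)).2⟩ : defectSpace (R†)) =
      R₀ ((W†) (ι u)) := rfl
    change V₁ (WithLp.toLp 2 (-⟨R ((W†) (ι u)), map_mem_defectSpace hR ((W†) (ι u)).2⟩,
      ι u - W ((W†) (ι u)))) = _
    rw [e, hV₁]
    -- By `hJW` and `V† i' = 0`, the term `(1 - V V†) J W` is `i' D_R`, which `p` kills; by `hVJ`,
    -- the term `-V R₀ W† ι u` is `V V† J ι u`. Only `p (J (ι u))` remains.
    simp only [map_sub, map_neg, map_add, hJW, hVi', hVJ, hV.adjoint_apply, hpi, map_zero]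
    abel
  · rw [hV₂]
    exact hDW u
  · rw [hV₁, hVD]
    simp [hpi]

end Compression

/-! ## The Julia operator -/

section Julia

variable {E F : Type*} [NormedAddCommGroup E] [InnerProductSpace ℂ E] [CompleteSpace E]
  [NormedAddCommGroup F] [InnerProductSpace ℂ F] [CompleteSpace F]

theorem norm_inl (x : E) : ‖inl E F x‖ = ‖x‖ := WithLp.norm_toLp_fst 2 E F x

theorem norm_inr (x : F) : ‖inr E F x‖ = ‖x‖ := WithLp.norm_toLp_snd 2 E F x

theorem inl_adjoint : (inl E F)† = WithLp.fstL 2 ℂ E F := by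
  symm
  rw [ContinuousLinearMap.eq_adjoint_iff]
  intro x y
  simp [inl]

theorem inr_adjoint : (inr E F)† = WithLp.sndL 2 ℂ E F := by
  symm
  rw [ContinuousLinearMap.eq_adjoint_iff]
  intro x y
  simp [inr]

/-- The Julia operator `(x, y) ↦ (-A x + D_{A*} y, D_A x + A* y)`. -/
def juliaOp (A : E →L[ℂ] F) : WithLp 2 (E × F) →L[ℂ] WithLp 2 (F × E) :=
  ((WithLp.prodContinuousLinearEquiv 2 ℂ F E).symm : F × E →L[ℂ] WithLp 2 (F × E)) ∘L
    ((-A ∘L WithLp.fstL 2 ℂ E F + defectOp (A†) ∘L WithLp.sndL 2 ℂ E F).prod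
      (defectOp A ∘L WithLp.fstL 2 ℂ E F + A† ∘L WithLp.sndL 2 ℂ E F))

theorem juliaOp_apply (A : E →L[ℂ] F) (x : WithLp 2 (E × F)) :
    juliaOp A x =
      WithLp.toLp 2 (-A x.fst + defectOp (A†) x.snd, defectOp A x.fst + (A†) x.snd) := rfl

theorem juliaOp_isIsometry {A : E →L[ℂ] F} (hA : ‖A‖ ≤ 1) : IsIsometry (juliaOp A) := by
  refine isIsometry_of_norm_eq fun x => ?_
  rw [← sq_eq_sq₀ (norm_nonneg _) (norm_nonneg _), WithLp.prod_norm_sq_eq_of_L2,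
    WithLp.prod_norm_sq_eq_of_L2]
  exact julia_norm hA x.fst x.snd

/-- The adjoint is again a Julia operator, hence an isometry when `A` is a contraction; together
with `juliaOp_isIsometry` this makes `J` unitary. -/
theorem juliaOp_adjoint (A : E →L[ℂ] F) : (juliaOp A)† = juliaOp (A†) := by
  symm
  rw [ContinuousLinearMap.eq_adjoint_iff]
  rintro ⟨x₁, x₂⟩ ⟨y₁, y₂⟩
  simp only [juliaOp_apply, WithLp.prod_inner_apply, inner_add_left, inner_add_right,
    inner_neg_left, inner_neg_right, ContinuousLinearMap.adjoint_adjoint,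
    ContinuousLinearMap.adjoint_inner_left, ContinuousLinearMap.adjoint_inner_right,
    inner_defectOp_left, WithLp.fst, WithLp.snd]
  ring

end Julia

/-! ## Compressions of row contractions -/

section Compression

variable {H : Type*} [NormedAddCommGroup H] [InnerProductSpace ℂ H] [CompleteSpace H] {n : ℕ}

/-- The compression of `T` to a closed subspace. -/
def compression (T : Fin n → H →L[ℂ] H) (M : Submodule ℂ H) [CompleteSpace M] (i : Fin n) :
    M →L[ℂ] M :=
  M.orthogonalProjectionOnto ∘L T i ∘L M.subtypeL

/-- The inclusion of `Mⁿ` into `Hⁿ`. -/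
def piInclusion (n : ℕ) (M : Submodule ℂ H) :
    PiLp 2 (fun _ : Fin n => M) →L[ℂ] PiLp 2 (fun _ : Fin n => H) :=
  ((PiLp.continuousLinearEquiv 2 ℂ fun _ : Fin n => H).symm :
      (Fin n → H) →L[ℂ] PiLp 2 (fun _ : Fin n => H)) ∘L
    ContinuousLinearMap.pi fun j => M.subtypeL ∘L PiLp.proj 2 (fun _ : Fin n => M) j

theorem piInclusion_apply (M : Submodule ℂ H) (x : PiLp 2 (fun _ : Fin n => M)) (j : Fin n) :
    piInclusion n M x j = x j := rfl

theorem norm_piInclusion (M : Submodule ℂ H) (x : PiLp 2 (fun _ : Fin n => M)) :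
    ‖piInclusion n M x‖ = ‖x‖ := by
  rw [← sq_eq_sq₀ (norm_nonneg _) (norm_nonneg _), PiLp.norm_sq_eq_of_L2, PiLp.norm_sq_eq_of_L2]
  rfl

theorem piInclusion_adjoint_apply (M : Submodule ℂ H) [CompleteSpace M]
    (x : PiLp 2 (fun _ : Fin n => H)) (j : Fin n) :
    ((piInclusion n M)†) x j = M.orthogonalProjectionOnto (x j) := by
  refine ext_inner_left ℂ fun v => ?_
  have h := ContinuousLinearMap.adjoint_inner_right (piInclusion n M) (PiLp.single 2 j v) x
  rw [PiLp.inner_apply, PiLp.inner_apply, Finset.sum_eq_single j, Finset.sum_eq_single j] at h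
  · rw [Submodule.inner_orthogonalProjectionOnto_eq_of_mem_left]
    simpa [piInclusion_apply] using h
  all_goals simp +contextual [piInclusion_apply]

theorem rowOp_apply (T : Fin n → H →L[ℂ] H) (x : PiLp 2 (fun _ : Fin n => H)) :
    rowOp T x = ∑ i, T i (x i) := by simp [rowOp]

theorem rowOp_compression (T : Fin n → H →L[ℂ] H) (M : Submodule ℂ H) [CompleteSpace M]
    (x : PiLp 2 (fun _ : Fin n => M)) :
    rowOp (compression T M) x = M.orthogonalProjectionOnto (rowOp T (piInclusion n M x)) := by
  simp [rowOp_apply, compression, piInclusion_apply]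

theorem IsRowContraction.compression {T : Fin n → H →L[ℂ] H} (hT : IsRowContraction T)
    (M : Submodule ℂ H) [CompleteSpace M] : IsRowContraction (compression T M) := by
  refine ContinuousLinearMap.opNorm_le_bound _ zero_le_one fun x => ?_
  rw [rowOp_compression, ← norm_piInclusion]
  exact (M.norm_orthogonalProjectionOnto_apply_le _).trans ((rowOp T).le_of_opNorm_le hT _)

theorem compression_adjoint_apply (T : Fin n → H →L[ℂ] H) (M : Submodule ℂ H) [CompleteSpace M]
    (i : Fin n) (x : M) :
    ((compression T M i)†) x = M.orthogonalProjectionOnto (((T i)†) x) := by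
  simp [compression, ContinuousLinearMap.adjoint_comp, Submodule.adjoint_subtypeL,
    Submodule.adjoint_orthogonalProjectionOnto]

/-- The coefficients of the characteristic function of a compression `N` of `T`, combined with
an identity summand and multiplied by constants, give the transfer function of the corresponding
compression of the Julia colligation of `T`. -/
theorem exists_factorization_charCoeff_compression (T : Fin n → H →L[ℂ] H)
    (hT : IsRowContraction T) (M : Submodule ℂ H) [CompleteSpace M] :
    ∃ (V₁ : WithLp 2 (DTs (compression T M) ×
          WithLp 2 (PiLp 2 (fun _ : Fin n => H) × H)) →L[ℂ] DTs T)
      (V₂ : DT T →L[ℂ] WithLp 2 (DT (compression T M) ×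
          WithLp 2 (PiLp 2 (fun _ : Fin n => H) × H))),
      IsCoisometry V₁ ∧ IsIsometry V₂ ∧
      (∀ u, V₁ (WithLp.toLp 2 (charCoeff (compression T M) (hT.compression M) [] (V₂ u).fst,
        (V₂ u).snd)) = charCoeff T hT [] u) ∧
      ∀ (α : List (Fin n)) (j : Fin n) (u : DT T),
        V₁ (WithLp.toLp 2 (charCoeff (compression T M) (hT.compression M) (α ++ [j]) (V₂ u).fst,
          0)) = defectMap T (wordProd (fun i => (compression T M i)†) α
            (M.orthogonalProjectionOnto (defectOp (rowOp T) u j))) := by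
  have hp : IsCoisometry
      ((DTs T).orthogonalProjectionOnto ∘L WithLp.fstL 2 ℂ H (PiLp 2 (fun _ : Fin n => H))) := by
    rw [IsCoisometry, ContinuousLinearMap.adjoint_comp,
      Submodule.adjoint_orthogonalProjectionOnto, ← inl_adjoint,
      ContinuousLinearMap.adjoint_adjoint]
    ext1 y
    rw [inl_adjoint]
    simp [inl]
  have hp' : ∀ y : DTs T, (DTs T).orthogonalProjectionOnto (y : H) = y :=
    Submodule.orthogonalProjectionOnto_mem_subspace_eq_self
  -- States sit in the second summands: `M` in the `H` of `Hⁿ ⊕ H`, and `Mⁿ` in the `Hⁿ` of `H ⊕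
  -- Hⁿ`. Inputs from `𝓓_T` and outputs to `𝓓_{T*}` use the first summands.
  obtain ⟨V₁, V₂, hV₁, hV₂, h₀, hu, hx⟩ := exists_factorization_of_compression
    (juliaOp_isIsometry hT)
    (by rw [juliaOp_adjoint]; exact juliaOp_isIsometry (norm_adjoint_le_one hT))
    (i := inr (PiLp 2 (fun _ : Fin n => H)) H ∘L M.subtypeL)
    (isIsometry_of_norm_eq fun x => norm_inr _)
    (i' := inr H (PiLp 2 (fun _ : Fin n => H)) ∘L piInclusion n M)
    (isIsometry_of_norm_eq fun x => (norm_inr _).trans (norm_piInclusion M x))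
    (ι := inl (PiLp 2 (fun _ : Fin n => H)) H ∘L (DT T).subtypeL)
    (isIsometry_of_norm_eq fun x => norm_inl _)
    (fun u => by
      rw [ContinuousLinearMap.adjoint_comp, inr_adjoint]
      simp [inl])
    hp (fun x => by simp [inr]) (R := rowOp (compression T M)) (hT.compression M)
    (fun x => by
      rw [ContinuousLinearMap.adjoint_comp, inr_adjoint, juliaOp_adjoint, rowOp_compression,
        Submodule.adjoint_subtypeL]
      simp [juliaOp_apply, inr])
  refine ⟨V₁, V₂, hV₁, hV₂, fun u => ?_, fun α j u => ?_⟩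
  · rw [charCoeff_nil, charCoeff_nil]
    refine (h₀ u).trans ?_
    have e : (DTs T).orthogonalProjectionOnto (rowOp T u) = rowRestrict T hT u :=
      hp' (rowRestrict T hT u)
    simp only [ContinuousLinearMap.comp_apply, juliaOp_apply]
    simpa [inl] using e
  · rw [charCoeff_append]
    refine (hx _).trans ?_
    -- The state `D_N (V₂ u).fst` of `N` equals the compressed state of `T`, with components `P_M
    -- (D_T u)_j`.
    rw [hu, ContinuousLinearMap.adjoint_comp, inr_adjoint]
    simp only [ContinuousLinearMap.comp_apply, juliaOp_apply]
    have e : ∀ x, (DTs T).orthogonalProjectionOnto (defectOp ((rowOp T)†) x) = defectMap T x :=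
      fun x => hp' (defectMap T x)
    simpa [inl, inr, piInclusion_adjoint_apply] using e _

end Compression

/-! ## The reduction to a nilpotent row contraction -/

section Reduction

variable {H : Type*} [NormedAddCommGroup H] [InnerProductSpace ℂ H] [CompleteSpace H] {n : ℕ}

/-- The vectors `x` with `D_{T*} T_{δ₁}* ⋯ T_{δₗ}* x = 0` for all words `δ` of length at least
`k`. -/
def tailKernel (T : Fin n → H →L[ℂ] H) (k : ℕ) : Submodule ℂ H :=
  ⨅ δ : {δ : List (Fin n) // k ≤ δ.length},
    LinearMap.ker (defectMap T ∘L wordProd (fun i => (T i)†) δ.1).toLinearMap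

theorem mem_tailKernel {T : Fin n → H →L[ℂ] H} {k : ℕ} {x : H} :
    x ∈ tailKernel T k ↔ ∀ δ : List (Fin n), k ≤ δ.length →
      defectMap T (wordProd (fun i => (T i)†) δ x) = 0 := by
  simp [tailKernel]

theorem isClosed_tailKernel (T : Fin n → H →L[ℂ] H) (k : ℕ) :
    IsClosed (tailKernel T k : Set H) := by
  rw [tailKernel, Submodule.coe_iInf]
  exact isClosed_iInter fun δ => ContinuousLinearMap.isClosed_ker _

theorem tailKernel_mono (T : Fin n → H →L[ℂ] H) {k l : ℕ} (h : k ≤ l) :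
    tailKernel T k ≤ tailKernel T l := fun _ hx =>
  mem_tailKernel.2 fun δ hδ => mem_tailKernel.1 hx δ (h.trans hδ)

/-- Each letter `T_i*` applied to `x` uses up one letter of the words tested against `x`, so it
lowers the index by one. -/
theorem wordProd_adjoint_mem_tailKernel {T : Fin n → H →L[ℂ] H} {k : ℕ} {x : H}
    (α : List (Fin n)) (hx : x ∈ tailKernel T (k + α.length)) :
    wordProd (fun i => (T i)†) α x ∈ tailKernel T k :=
  mem_tailKernel.2 fun δ hδ => by
    rw [← wordProd_append]
    exact mem_tailKernel.1 hx _ (by simpa using hδ)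

theorem adjoint_mem_tailKernel {T : Fin n → H →L[ℂ] H} {k : ℕ} {x : H} (i : Fin n)
    (hx : x ∈ tailKernel T k) : ((T i)†) x ∈ tailKernel T k := by
  have h := wordProd_adjoint_mem_tailKernel [i] (tailKernel_mono T (Nat.le_add_right k 1) hx)
  simpa [wordProd] using h

/-- The space on which the nilpotent part of `T` acts. -/
def nilpotentSpace (T : Fin n → H →L[ℂ] H) (m : ℕ) : Submodule ℂ H :=
  tailKernel T m ⊓ (tailKernel T 0)ᗮ

instance (T : Fin n → H →L[ℂ] H) (m : ℕ) : CompleteSpace (nilpotentSpace T m) :=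
  ((isClosed_tailKernel T m).inter (Submodule.isClosed_orthogonal _)).completeSpace_coe

/-- On `K_m = M ⊕ K_0` the projection to `M` only removes the `K_0` component. -/
theorem projection_sub_mem_tailKernel {T : Fin n → H →L[ℂ] H} {m : ℕ} {x : H}
    (hx : x ∈ tailKernel T m) :
    ((nilpotentSpace T m).orthogonalProjectionOnto x : H) - x ∈ tailKernel T 0 := by
  have : CompleteSpace (tailKernel T 0) := (isClosed_tailKernel T 0).completeSpace_coe
  set w := (tailKernel T 0).starProjection x
  have hw : w ∈ tailKernel T 0 := Submodule.starProjection_apply_mem _ x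
  have h : (nilpotentSpace T m).starProjection x = x - w := by
    refine Submodule.eq_starProjection_of_mem_orthogonal
      ⟨sub_mem hx (tailKernel_mono T (Nat.zero_le m) hw),
        Submodule.sub_starProjection_mem_orthogonal x⟩ ?_
    rw [sub_sub_cancel, Submodule.mem_orthogonal]
    exact fun u hu => Submodule.inner_left_of_mem_orthogonal hw hu.2
  rw [Submodule.coe_orthogonalProjectionOnto_apply, h, sub_sub_cancel_left]
  exact neg_mem hw

/-- `K_m` and `K_0` are invariant under the `T_i*`, so the `N_i*` act on `K_m / K_0` as the `T_i*`
do; the errors made by projecting stay in `K_0`. -/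
theorem wordProd_compression_sub_mem_tailKernel {T : Fin n → H →L[ℂ] H} {m : ℕ} {x : H}
    (hx : x ∈ tailKernel T m) (α : List (Fin n)) :
    (wordProd (fun i => (compression T (nilpotentSpace T m) i)†) α
        ((nilpotentSpace T m).orthogonalProjectionOnto x) : H) -
      wordProd (fun i => (T i)†) α x ∈ tailKernel T 0 := by
  induction α with
  | nil => simpa [wordProd] using projection_sub_mem_tailKernel hx
  | cons i α ih =>
    rw [wordProd_cons, wordProd_cons, compression_adjoint_apply]
    set y := wordProd (fun i => (compression T (nilpotentSpace T m) i)†) α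
      ((nilpotentSpace T m).orthogonalProjectionOnto x)
    have h1 := projection_sub_mem_tailKernel (adjoint_mem_tailKernel i y.2.1)
    have h2 := adjoint_mem_tailKernel i ih
    rw [map_sub] at h2
    simpa using add_mem h1 h2

theorem defectMap_wordProd_compression {T : Fin n → H →L[ℂ] H} {m : ℕ} {x : H}
    (hx : x ∈ tailKernel T m) (α : List (Fin n)) :
    defectMap T (wordProd (fun i => (compression T (nilpotentSpace T m) i)†) α
        ((nilpotentSpace T m).orthogonalProjectionOnto x)) =
      defectMap T (wordProd (fun i => (T i)†) α x) := by
  rw [← sub_eq_zero, ← map_sub]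
  have h := mem_tailKernel.1 (wordProd_compression_sub_mem_tailKernel hx α) [] le_rfl
  simpa [wordProd] using h

theorem wordProd_compression_eq_zero (T : Fin n → H →L[ℂ] H) {m : ℕ} {α : List (Fin n)}
    (hα : α.length = m) : wordProd (compression T (nilpotentSpace T m)) α = 0 := by
  -- For `x` in `M`, the vector `y` agrees modulo `K_0` with a word of length `m` in the `T_i*`
  -- applied to `x`, which lies in `K_0`. So `y` is in `K_0` and orthogonal to it.
  have h : (wordProd (compression T (nilpotentSpace T m)) α)† = 0 := by
    rw [wordProd_adjoint]
    ext1 x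
    have hx : (x : H) ∈ tailKernel T m := x.2.1
    have h1 := wordProd_compression_sub_mem_tailKernel hx α.reverse
    rw [Submodule.orthogonalProjectionOnto_mem_subspace_eq_self] at h1
    have h2 : wordProd (fun i => (T i)†) α.reverse (x : H) ∈ tailKernel T 0 :=
      wordProd_adjoint_mem_tailKernel _ (by simpa [hα] using hx)
    set y := wordProd (fun i => (compression T (nilpotentSpace T m) i)†) α.reverse x
    have h3 : (y : H) ∈ tailKernel T 0 := by simpa using add_mem h1 h2
    have h4 : inner ℂ (y : H) y = 0 := Submodule.inner_right_of_mem_orthogonal h3 y.2.2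
    exact Subtype.ext (inner_self_eq_zero.1 h4)
  rw [← ContinuousLinearMap.adjoint_adjoint (wordProd _ α), h, map_zero]

theorem exists_isNilpotentOfOrder {N : Fin n → H →L[ℂ] H} {m : ℕ}
    (h : ∀ α : List (Fin n), α.length = m → wordProd N α = 0) :
    ∃ k ≤ m, IsNilpotentOfOrder N k := by
  classical
  have hex : ∃ k, ∀ α : List (Fin n), α.length = k → wordProd N α = 0 := ⟨m, h⟩
  refine ⟨Nat.find hex, Nat.find_min' hex h, Nat.find_spec hex, fun j hj => ?_⟩
  have := Nat.find_min hex hj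
  push Not at this
  exact this

/-- The one place where polynomiality enters: the coefficient at `δ j` is `D_{T*} T_{δ₁}* ⋯ T_{δₗ}*`
applied to `(D_T u)_j`, and the extra letter `j` turns length at least `m` into length above `m`. -/
theorem defectOp_mem_tailKernel {T : Fin n → H →L[ℂ] H} (hT : IsRowContraction T) {m : ℕ}
    (h : ∀ β : List (Fin n), m < β.length → charCoeff T hT β = 0) (u : DT T) (j : Fin n) :
    defectOp (rowOp T) u j ∈ tailKernel T m :=
  mem_tailKernel.2 fun δ hδ => by
    rw [← charCoeff_append T hT, h _ (by simpa using Nat.lt_succ_of_le hδ)]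
    rfl

end Reduction

/-- A factorization of the coefficients of `Θ_T` through those of `Θ_N` and an identity summand
is one of the operators. -/
theorem charFun_eq_of_charCoeff {H H₀ E : Type*} [NormedAddCommGroup H] [InnerProductSpace ℂ H]
    [CompleteSpace H] [NormedAddCommGroup H₀] [InnerProductSpace ℂ H₀] [CompleteSpace H₀]
    [NormedAddCommGroup E] [InnerProductSpace ℂ E] {n : ℕ}
    {T : Fin n → H →L[ℂ] H} (hT : IsRowContraction T)
    {N : Fin n → H₀ →L[ℂ] H₀} (hN : IsRowContraction N)
    (V₁ : WithLp 2 (DTs N × E) →L[ℂ] DTs T) (V₂ : DT T →L[ℂ] WithLp 2 (DT N × E))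
    (h₀ : ∀ u, V₁ (WithLp.toLp 2 (charCoeff N hN [] (V₂ u).fst, (V₂ u).snd)) =
      charCoeff T hT [] u)
    (h : ∀ (α : List (Fin n)) (j : Fin n) (u : DT T),
      V₁ (WithLp.toLp 2 (charCoeff N hN (α ++ [j]) (V₂ u).fst, 0)) =
        charCoeff T hT (α ++ [j]) u) :
    charFun T hT =
      ampl n V₁ ∘L fockDiag (charFun N hN) (1 : Fock n E →L[ℂ] Fock n E) ∘L ampl n V₂ := by
  refine (charFun_isMultiAnalytic T hT).ext ((isMultiAnalytic_ampl V₁).comp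
    (((charFun_isMultiAnalytic N hN).fockDiag isMultiAnalytic_one).comp
      (isMultiAnalytic_ampl V₂))) fun α => ?_
  rw [fourierCoeff_ampl_comp, fourierCoeff_comp_ampl, fourierCoeff_charFun]
  ext1 u
  rw [ContinuousLinearMap.comp_apply, ContinuousLinearMap.comp_apply, fourierCoeff_fockDiag_apply,
    fourierCoeff_charFun, fourierCoeff_one]
  -- The identity summand contributes only at the empty word, whence the `(V₂ u).snd` in `h₀` and
  -- the `0` in `h`.
  rcases List.eq_nil_or_concat α with rfl | ⟨δ, j, rfl⟩
  · rw [if_pos rfl]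
    exact (h₀ u).symm
  · rw [List.concat_eq_append, if_neg (by simp), h]

end

end RowOperators

theorem mainTheorem9 {n m : ℕ} {H : Type u} [NormedAddCommGroup H] [InnerProductSpace ℂ H]
    [CompleteSpace H] (T : Fin n → H →L[ℂ] H) (hT : RowOperators.IsRowContraction T)
    (hpoly : RowOperators.IsPolynomialOfDegree (RowOperators.charFun T hT) m) :
    ∃ (E : Type u) (_ : NormedAddCommGroup E) (_ : InnerProductSpace ℂ E) (_ : CompleteSpace E)
      (H₀ : Type u) (_ : NormedAddCommGroup H₀) (_ : InnerProductSpace ℂ H₀)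
      (_ : CompleteSpace H₀) (N : Fin n → H₀ →L[ℂ] H₀) (hN : RowOperators.IsRowContraction N),
      (∃ k ≤ m, RowOperators.IsNilpotentOfOrder N k) ∧
      ∃ (G₁ : RowOperators.Fock n (WithLp 2 (RowOperators.DTs N × E)) →L[ℂ]
            RowOperators.Fock n (RowOperators.DTs T))
        (G₂ : RowOperators.Fock n (RowOperators.DT T) →L[ℂ]
            RowOperators.Fock n (WithLp 2 (RowOperators.DT N × E))),
        RowOperators.IsCoisometry G₁ ∧ RowOperators.IsIsometry G₂ ∧
        (∃ V₁ : WithLp 2 (RowOperators.DTs N × E) →L[ℂ] RowOperators.DTs T,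
          G₁ = RowOperators.ampl n V₁) ∧
        (∃ V₂ : RowOperators.DT T →L[ℂ] WithLp 2 (RowOperators.DT N × E),
          G₂ = RowOperators.ampl n V₂) ∧
        RowOperators.charFun T hT =
          G₁ ∘L RowOperators.fockDiag (RowOperators.charFun N hN)
            (1 : RowOperators.Fock n E →L[ℂ] RowOperators.Fock n E) ∘L G₂ := by
  have hc (β : List (Fin n)) (hβ : m < β.length) : RowOperators.charCoeff T hT β = 0 := by
    rw [← RowOperators.fourierCoeff_charFun, hpoly.1 β hβ]
  obtain ⟨V₁, V₂, hV₁, hV₂, h₀, h⟩ := RowOperators.exists_factorization_charCoeff_compression T hT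
    (RowOperators.nilpotentSpace T m)
  -- The space `𝓔` is the whole domain `Hⁿ ⊕ H` of the Julia operator.
  refine ⟨WithLp 2 (PiLp 2 (fun _ : Fin n => H) × H), inferInstance, inferInstance, inferInstance,
    RowOperators.nilpotentSpace T m, inferInstance, inferInstance, inferInstance,
    RowOperators.compression T (RowOperators.nilpotentSpace T m), hT.compression _,
    RowOperators.exists_isNilpotentOfOrder
      fun α => RowOperators.wordProd_compression_eq_zero T,
    RowOperators.ampl n V₁, RowOperators.ampl n V₂, hV₁.ampl, hV₂.ampl, ⟨V₁, rfl⟩, ⟨V₂, rfl⟩,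
    RowOperators.charFun_eq_of_charCoeff hT _ V₁ V₂ h₀ fun α j u => ?_⟩
  rw [h, RowOperators.defectMap_wordProd_compression
    (RowOperators.defectOp_mem_tailKernel hT hc u j), RowOperators.charCoeff_append]
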